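/- Let $H(\mathbb C)$ be the algebra of entire functions with the compact-open topology, and let $\Phi(z)=\sum_{n\ge 0}a_nz^n$ be an entire function of exponential type (i.e. of order less than $1$, or of order $1$ and finite type; constant functions have order $0$). Let $\Phi(D):H(\mathbb C)\to H(\mathbb C)$, $f\mapsto\sum_{n\ge 0}a_nD^nf$, where $D$ is complex differentiation. Suppose there are $z_0,z_1\in\mathbb C$ with $z_1\neq 0$ and $z_0$ in the open segment $(0,z_1)=\{tz_1:0<t<1\}$ such that (i) $|\Phi(z)|<1$ for every $z\in(0,z_0]=\{tz_0:0<t\le 1\}$, and (ii) $|\Phi(z_1)|>\max\{1,e^{\tau_0|z_1|}\}$, where $$\tau_0=\limsup_{r\to\infty}\frac{\log\left|\Phi\left(r\frac{z_1}{|z_1|}\right)\right|}{r}.$$ Then $\Phi(D)$ supports a hypercyclic algebra: there is a non-zero (not necessarily unital) subalgebra $A$ of $H(\mathbb C)$ such that every non-zero $f\in A$ has a dense orbit $\{\Phi(D)^nf:n\ge 0\}$ in $H(\mathbb C)$. -/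

import Mathlib

open Filter Topology

noncomputable section

/-! ### Growth of entire functions -/

/-- The maximum modulus `M(r) = sup_{|z| ≤ r} |f z|`. -/
def maxModulus (f : ℂ → ℂ) (r : ℝ) : ℝ :=
  sSup ((fun z => ‖f z‖) '' Metric.closedBall (0 : ℂ) r)

open Classical in
/-- The order of an entire function: zero for constants, and otherwise
`limsup_{r → ∞} log log M(r) / log r`, taken in the extended reals. (For a non-constant entire
function `M(r) → ∞`, so the logarithms are genuine for all large `r`.) -/
def growthOrder (f : ℂ → ℂ) : EReal :=
  if ∃ c : ℂ, ∀ z, f z = c then 0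
  else limsup
    (fun r : ℝ => ((Real.log (Real.log (maxModulus f r)) / Real.log r : ℝ) : EReal)) atTop

/-- The type `limsup_{r → ∞} r^{-ρ} log M(r)` of an entire function of finite order `ρ`. -/
def growthType (f : ℂ → ℂ) : EReal :=
  limsup
    (fun r : ℝ => ((Real.log (maxModulus f r) / r ^ (growthOrder f).toReal : ℝ) : EReal)) atTop

/-- Growth `(ρ, τ)`: order less than `ρ`, or order `ρ` and type not exceeding `τ`. -/
def IsOfGrowth (f : ℂ → ℂ) (ρ τ : ℝ) : Prop :=
  growthOrder f < (ρ : EReal) ∨ (growthOrder f = (ρ : EReal) ∧ growthType f ≤ (τ : EReal))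

/-- Exponential type: growth `(1, τ)` for some `τ < ∞`. -/
def IsOfExponentialType (f : ℂ → ℂ) : Prop :=
  ∃ τ : ℝ, IsOfGrowth f 1 τ

/-- The growth rate `τ₀(w) = limsup_{r → ∞} log |f (r w / |w|)| / r` along the ray through `w ≠ 0`,
taken in the extended reals with `log 0 = -∞`. -/
def rayGrowth (f : ℂ → ℂ) (w : ℂ) : EReal :=
  limsup (fun r : ℝ => ENNReal.log ‖f ((r : ℂ) * (w / (‖w‖ : ℂ)))‖ₑ / (r : EReal)) atTop

/-! ### The topological algebra of entire functions -/

/-- The algebra `H(ℂ)` of entire functions. As a subalgebra of `C(ℂ, ℂ)` it carries the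
compact-open topology and the pointwise operations. -/
def EntireFunctions : Subalgebra ℂ C(ℂ, ℂ) where
  carrier := {f | Differentiable ℂ f}
  mul_mem' hf hg := Differentiable.mul hf hg
  add_mem' hf hg := Differentiable.add hf hg
  algebraMap_mem' c := differentiable_const c

instance : CoeFun EntireFunctions (fun _ => ℂ → ℂ) := ⟨fun f => f.1⟩

theorem differentiable_entire (f : EntireFunctions) : Differentiable ℂ (f : ℂ → ℂ) := f.2

/-- Complex differentiation `D` on `H(ℂ)`. -/
def complexD : EntireFunctions →ₗ[ℂ] EntireFunctions where
  toFun f := ⟨⟨deriv f, (differentiable_entire f).deriv.continuous⟩, (differentiable_entire f).deriv⟩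
  map_add' f g := by
    apply Subtype.ext; ext z
    exact deriv_add ((differentiable_entire f) z) ((differentiable_entire g) z)
  map_smul' c f := by
    apply Subtype.ext; ext z
    exact deriv_const_smul_field c (f : ℂ → ℂ)

/-- The `n`-th Taylor coefficient at the origin. -/
def taylorCoeff (Φ : EntireFunctions) (n : ℕ) : ℂ :=
  iteratedDeriv n Φ 0 / (n.factorial : ℂ)

/-- The operator `Φ(D) : f ↦ ∑ aₙ Dⁿ f`, where `Φ(z) = ∑ aₙ zⁿ`, the series being summed in the
topology of `H(ℂ)`. It converges for every `f` when `Φ` is of exponential type; see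
`hasSum_convolutionOperator` below. -/
def convolutionOperator (Φ : EntireFunctions) (f : EntireFunctions) : EntireFunctions :=
  ∑' n : ℕ, taylorCoeff Φ n • (complexD ^ n) f

/-! ### Hypercyclicity -/

/-- A vector whose orbit `{x, T x, T² x, …}` is dense. -/
def IsHypercyclicVector {X : Type*} [TopologicalSpace X] (T : X → X) (x : X) : Prop :=
  Dense (Set.range fun n : ℕ => T^[n] x)

/-- `T` supports a hypercyclic algebra: some non-zero subalgebra (not required to contain the
unit) consists, except for zero, of hypercyclic vectors. -/
def SupportsHypercyclicAlgebra (𝕜 : Type*) {X : Type*} [Field 𝕜] [Ring X] [Algebra 𝕜 X]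
    [TopologicalSpace X] (T : X → X) : Prop :=
  ∃ A : NonUnitalSubalgebra 𝕜 X, A ≠ ⊥ ∧ ∀ x ∈ A, x ≠ 0 → IsHypercyclicVector T x

/-! ### The series defining `Φ(D)` converges -/

theorem norm_le_maxModulus (f : EntireFunctions) (z : ℂ) : ‖f z‖ ≤ maxModulus f ‖z‖ := by
  refine le_csSup ?_ ⟨z, by simp, rfl⟩
  exact ((isCompact_closedBall (0 : ℂ) ‖z‖).image
    (differentiable_entire f).continuous.norm).bddAbove

theorem IsOfExponentialType.exists_bound {Φ : EntireFunctions} (h : IsOfExponentialType Φ) :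
    ∃ A B : ℝ, 0 ≤ A ∧ 0 ≤ B ∧ ∀ z, ‖Φ z‖ ≤ A * Real.exp (B * ‖z‖) := by
  have key : (∃ c : ℂ, ∀ z, Φ z = c) ∨
      ∃ B : ℝ, 0 ≤ B ∧ ∀ᶠ r : ℝ in atTop, maxModulus Φ r ≤ Real.exp (B * r) := by
    by_cases hc : ∃ c : ℂ, ∀ z, Φ z = c
    · exact Or.inl hc
    right
    obtain ⟨τ, h | ⟨h₁, h₂⟩⟩ := h
    · refine ⟨1, zero_le_one, ?_⟩
      rw [growthOrder, if_neg hc] at h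
      filter_upwards [eventually_lt_of_limsup_lt h, eventually_gt_atTop 1] with r hr hr1
      have hr' : Real.log (Real.log (maxModulus Φ r)) / Real.log r < 1 := by exact_mod_cast hr
      rw [div_lt_one (Real.log_pos hr1)] at hr'
      rw [one_mul]
      by_cases hM : maxModulus Φ r ≤ 1
      · exact hM.trans (Real.one_le_exp (by linarith))
      · push Not at hM
        have hl := Real.log_pos hM
        have := (Real.log_lt_log_iff hl (by linarith)).1 hr'
        exact ((Real.log_lt_iff_lt_exp (by linarith)).1 this).le
    · refine ⟨max (τ + 1) 0, le_max_right _ _, ?_⟩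
      have h₃ : growthType Φ < ((τ + 1 : ℝ) : EReal) :=
        lt_of_le_of_lt h₂ (by exact_mod_cast lt_add_one τ)
      rw [growthType, h₁] at h₃
      filter_upwards [eventually_lt_of_limsup_lt h₃, eventually_gt_atTop 0] with r hr hr0
      have hr' : Real.log (maxModulus Φ r) / r < τ + 1 := by
        have := EReal.coe_lt_coe_iff.1 hr
        simpa using this
      rw [div_lt_iff₀ hr0] at hr'
      by_cases hM : maxModulus Φ r ≤ 0
      · exact hM.trans (Real.exp_pos _).le
      · push Not at hM
        refine ((Real.log_lt_iff_lt_exp hM).1 hr').le.trans ?_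
        gcongr
        exact le_max_left _ _
  obtain ⟨c, hc⟩ | ⟨B, hB, hr⟩ := key
  · exact ⟨‖c‖, 0, norm_nonneg _, le_rfl, fun z => by simp [hc]⟩
  · obtain ⟨R, hR⟩ := eventually_atTop.1 hr
    obtain ⟨M, hM⟩ := (isCompact_closedBall (0 : ℂ) R).exists_bound_of_continuousOn
      (differentiable_entire Φ).continuous.continuousOn
    refine ⟨max M 1, B, by positivity, hB, fun z => ?_⟩
    have he : 1 ≤ Real.exp (B * ‖z‖) := Real.one_le_exp (by positivity)
    rcases le_total ‖z‖ R with hz | hz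
    · calc ‖Φ z‖ ≤ max M 1 := (hM z (by simpa using hz)).trans (le_max_left _ _)
        _ ≤ _ := le_mul_of_one_le_right (by positivity) he
    · calc ‖Φ z‖ ≤ Real.exp (B * ‖z‖) := (norm_le_maxModulus Φ z).trans (hR _ hz)
        _ ≤ _ := le_mul_of_one_le_left (by positivity) (le_max_right _ _)

theorem IsOfExponentialType.exists_taylorCoeff_bound {Φ : EntireFunctions}
    (h : IsOfExponentialType Φ) :
    ∃ A C : ℝ, 0 ≤ A ∧ 0 < C ∧ ∀ n, ‖taylorCoeff Φ n‖ ≤ A * C ^ n / n.factorial := by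
  obtain ⟨A, B, hA, -, hb⟩ := h.exists_bound
  refine ⟨A, Real.exp B, hA, Real.exp_pos _, fun n => ?_⟩
  rcases Nat.eq_zero_or_pos n with rfl | hn
  · simpa [taylorCoeff] using hb 0
  have hn' : (0 : ℝ) < n := by exact_mod_cast hn
  have hfac : (0 : ℝ) < n.factorial := by exact_mod_cast n.factorial_pos
  have h1 := Complex.norm_iteratedDeriv_le_of_forall_mem_sphere_norm_le (c := 0) n hn'
    ((differentiable_entire Φ).diffContOnCl) (C := A * Real.exp B ^ n) (fun z hz => by
      have : ‖z‖ = n := by simpa using hz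
      have h2 := hb z
      rwa [this, mul_comm B, Real.exp_nat_mul] at h2)
  rw [taylorCoeff, norm_div, Complex.norm_natCast]
  have h3 : (n.factorial : ℝ) ≤ (n : ℝ) ^ n := by exact_mod_cast n.factorial_le_pow
  calc _ ≤ (n.factorial * (A * Real.exp B ^ n) / (n : ℝ) ^ n) / n.factorial := by gcongr
    _ = (A * Real.exp B ^ n) / (n : ℝ) ^ n := by field_simp
    _ ≤ _ := by gcongr

theorem complexD_pow_apply (f : EntireFunctions) (n : ℕ) (z : ℂ) :
    ((complexD ^ n) f : EntireFunctions) z = iteratedDeriv n f z := by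
  induction n generalizing z with
  | zero => simp
  | succ n ih =>
    rw [pow_succ', Module.End.mul_apply, iteratedDeriv_succ]
    change deriv ((complexD ^ n) f : EntireFunctions) z = _
    congr 1
    exact funext ih

theorem isClosed_entireFunctions : IsClosed (EntireFunctions : Set C(ℂ, ℂ)) := by
  refine isClosed_of_closure_subset fun g hg => ?_
  have : (𝓝[(EntireFunctions : Set C(ℂ, ℂ))] g).NeBot := mem_closure_iff_nhdsWithin_neBot.1 hg
  have hlim := ContinuousMap.tendsto_iff_tendstoLocallyUniformly.1
    (tendsto_id.mono_left (nhdsWithin_le_nhds (a := g) (s := (EntireFunctions : Set C(ℂ, ℂ)))))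
  have hd := (tendstoLocallyUniformlyOn_univ.2 hlim).differentiableOn
    (eventually_mem_nhdsWithin.mono fun F hF => Differentiable.differentiableOn hF) isOpen_univ
  exact differentiableOn_univ.1 hd

/-- For `Φ` of exponential type and `f` entire, `∑ aₙ Dⁿ f` converges in `H(ℂ)` to `Φ(D) f`. -/
theorem hasSum_convolutionOperator {Φ : EntireFunctions} (h : IsOfExponentialType Φ)
    (f : EntireFunctions) :
    HasSum (fun n : ℕ => taylorCoeff Φ n • (complexD ^ n) f) (convolutionOperator Φ f) := by
  apply Summable.hasSum
  obtain ⟨A, C, hA, hC, hb⟩ := h.exists_taylorCoeff_bound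
  have hs : Summable fun n : ℕ =>
      ((taylorCoeff Φ n • (complexD ^ n) f : EntireFunctions) : C(ℂ, ℂ)) := by
    refine ContinuousMap.summable_of_locally_summable_norm fun K => ?_
    obtain ⟨r, hr⟩ := K.isCompact.isBounded.subset_closedBall (0 : ℂ)
    obtain ⟨M, hM⟩ := (isCompact_closedBall (0 : ℂ) (r + 2 * C)).exists_bound_of_continuousOn
      (differentiable_entire f).continuous.continuousOn
    refine Summable.of_nonneg_of_le (fun _ => norm_nonneg _) (fun n => ?_)
      (summable_geometric_two.mul_left (A * max M 0))
    refine (ContinuousMap.norm_le _ (by positivity)).2 fun z => ?_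
    have hz : ‖(z : ℂ)‖ ≤ r := by simpa using hr z.2
    have hfac : (0 : ℝ) < n.factorial := by exact_mod_cast n.factorial_pos
    have h1 := Complex.norm_iteratedDeriv_le_of_forall_mem_sphere_norm_le (c := (z : ℂ)) n
      (R := 2 * C) (by positivity) (differentiable_entire f).diffContOnCl (C := max M 0) (fun w hw => by
        refine (hM w ?_).trans (le_max_left _ _)
        rw [mem_sphere_iff_norm] at hw
        rw [mem_closedBall_zero_iff]
        calc ‖w‖ = ‖(z : ℂ) + (w - z)‖ := by ring_nf
          _ ≤ _ := (norm_add_le _ _).trans (by rw [hw]; linarith))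
    have h2 : (((taylorCoeff Φ n • (complexD ^ n) f : EntireFunctions) : C(ℂ, ℂ)).restrict K) z
        = taylorCoeff Φ n * iteratedDeriv n f z := by
      rw [← complexD_pow_apply]; rfl
    rw [h2, norm_mul]
    calc _ ≤ (A * C ^ n / n.factorial) * (n.factorial * max M 0 / (2 * C) ^ n) := by
          gcongr
          exact hb n
      _ = A * max M 0 * (1 / 2) ^ n := by
          rw [mul_pow, div_pow, one_pow]; field_simp
  obtain ⟨g, hg⟩ := hs
  have hgm : g ∈ EntireFunctions :=
    isClosed_entireFunctions.mem_of_tendsto hg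
      (Eventually.of_forall fun s => sum_mem fun i _ => Subtype.property _)
  refine ⟨⟨g, hgm⟩, ?_⟩
  exact (Topology.IsInducing.hasSum_iff (g := EntireFunctions.val)
    Topology.IsInducing.subtypeVal _ _).1 hg

end

noncomputable section

/-! ### The topological algebra `H(ℂ)`. -/

namespace EntireFunctions

/-! Exponentials are eigenvectors: `Φ(D) e^{lz} = Φ(l) e^{lz}`. By a Baire argument it suffices, for
each `m`, to find `f` near a given function and `q` such that `Φ(D)^q` sends `f ^ m` near a given
target and the lower powers of `f` near `0` (`supportsHypercyclicAlgebra_of_transitivity`).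

Take `f = ∑ α_g e^{gz} + ∑ β_l μ_l^q e^{lz/m}`, with small frequencies `g` where `|Φ| < 1`,
frequencies `l` near a point `w` with `|Φ(w)| > 1`, and `μ_l ^ m = 1/Φ(l)`. Expanding `f ^ m`, the
pure powers of the second kind are sent exactly to `β_l^m e^{lz}`. Every other term must decay
(`transitivity_of_frequencies`). Terms with `0 < k < m` factors of the second kind decay if
`|Φ(kw/m)| < |Φ(w)|^{k/m}`; this holds when `w = s z₁` with `s` the first maximiser of `|Φ(x
z₁)|^{1/x}` (`exists_strict_record`). Mixed terms with `k = m` decay by strict convexity of `log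
|Φ|` along a segment near `w` (`exists_strictConvexOn_log_norm`).

Such a segment exists unless `Φ(z) = b e^{az}`, and the growth condition on the ray through `z₁`
rules this out (`not_const_mul_exp`). -/

theorem isInducing_coe : IsInducing ((↑) : EntireFunctions → C(ℂ, ℂ)) :=
  IsInducing.subtypeVal

instance : ContinuousAdd EntireFunctions :=
  ⟨isInducing_coe.continuous_iff.2 ((continuous_subtype_val.comp continuous_fst).add
    (continuous_subtype_val.comp continuous_snd))⟩

instance : ContinuousMul EntireFunctions :=
  ⟨isInducing_coe.continuous_iff.2 ((continuous_subtype_val.comp continuous_fst).mul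
    (continuous_subtype_val.comp continuous_snd))⟩

instance : ContinuousNeg EntireFunctions :=
  ⟨isInducing_coe.continuous_iff.2 continuous_subtype_val.neg⟩

instance : IsTopologicalAddGroup EntireFunctions where

instance : SecondCountableTopology EntireFunctions :=
  isInducing_coe.secondCountableTopology

instance : BaireSpace EntireFunctions := by
  have : CompleteSpace EntireFunctions := isClosed_entireFunctions.isComplete.completeSpace_coe
  have : (uniformity EntireFunctions).IsCountablyGenerated := by
    change (Filter.comap _ _).IsCountablyGenerated
    infer_instance
  infer_instance

instance : LocallyConvexSpace ℝ EntireFunctions :=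
  LocallyConvexSpace.induced (F := C(ℂ, ℂ)) ((EntireFunctions.val.toLinearMap).restrictScalars ℝ)

theorem ext {f g : EntireFunctions} (h : ∀ z, f z = g z) : f = g :=
  Subtype.ext (ContinuousMap.ext h)

/-- Evaluation at a point, as a continuous linear functional. -/
def evalCLM (z : ℂ) : EntireFunctions →L[ℂ] ℂ where
  toFun f := f z
  map_add' _ _ := rfl
  map_smul' _ _ := rfl
  cont := (continuous_eval_const z).comp continuous_subtype_val

@[simp] theorem evalCLM_apply (z : ℂ) (f : EntireFunctions) : evalCLM z f = f z := rfl

/-! ### Exponentials, monomials and Taylor series. -/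

/-- The exponential `z ↦ e^{lz}`. -/
def exponential (l : ℂ) : EntireFunctions :=
  ⟨⟨fun z => Complex.exp (l * z), by fun_prop⟩,
    show Differentiable ℂ fun z => Complex.exp (l * z) by fun_prop⟩

@[simp] theorem exponential_apply (l z : ℂ) : exponential l z = Complex.exp (l * z) := rfl

theorem prod_exponential {ι : Type*} (s : Finset ι) (l : ι → ℂ) :
    ∏ i ∈ s, exponential (l i) = exponential (∑ i ∈ s, l i) := by
  classical
  induction s using Finset.induction_on with
  | empty => exact ext fun z => by simp
  | insert a s ha ih =>
    rw [Finset.prod_insert ha, Finset.sum_insert ha, ih]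
    exact ext fun z => by simp [add_mul, Complex.exp_add]

/-- The monomial `z ↦ zⁿ`. -/
def monomial (n : ℕ) : EntireFunctions :=
  ⟨⟨fun z => z ^ n, by fun_prop⟩, show Differentiable ℂ fun z : ℂ => z ^ n by fun_prop⟩

@[simp] theorem monomial_apply (n : ℕ) (z : ℂ) : monomial n z = z ^ n := rfl

theorem summable_of_bound {u : ℕ → EntireFunctions}
    (h : ∀ r : ℝ, 0 ≤ r → ∃ b : ℕ → ℝ, Summable b ∧ ∀ n z, ‖z‖ ≤ r → ‖u n z‖ ≤ b n) :
    Summable fun n => (u n : C(ℂ, ℂ)) := by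
  refine ContinuousMap.summable_of_locally_summable_norm fun K => ?_
  obtain ⟨r, hr⟩ := K.isCompact.isBounded.subset_closedBall (0 : ℂ)
  obtain ⟨b, hb, hub⟩ := h (max r 0) (le_max_right _ _)
  refine Summable.of_nonneg_of_le (fun _ => norm_nonneg _) (fun n => ?_) hb
  refine (ContinuousMap.norm_le _ ((norm_nonneg _).trans (hub n 0 (by simp)))).2 fun z => ?_
  exact hub n z ((by simpa using hr z.2 : ‖(z : ℂ)‖ ≤ r).trans (le_max_left _ _))

theorem norm_taylorCoeff_le (f : EntireFunctions) {R : ℝ} (hR : 0 < R) :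
    ∃ M : ℝ, 0 ≤ M ∧ ∀ n, ‖taylorCoeff f n‖ ≤ M / R ^ n := by
  obtain ⟨M, hM⟩ := (isCompact_closedBall (0 : ℂ) R).exists_bound_of_continuousOn
    (differentiable_entire f).continuous.continuousOn
  refine ⟨M, (norm_nonneg _).trans (hM 0 (by simp [hR.le])), fun n => ?_⟩
  have h1 := Complex.norm_iteratedDeriv_le_of_forall_mem_sphere_norm_le (c := 0) n hR
    ((differentiable_entire f).diffContOnCl) (C := M)
    (fun z hz => hM z (Metric.sphere_subset_closedBall hz))
  have hfac : (0 : ℝ) < n.factorial := by exact_mod_cast n.factorial_pos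
  rw [taylorCoeff, norm_div, Complex.norm_natCast, div_le_iff₀ hfac]
  exact h1.trans (le_of_eq (by ring))

theorem hasSum_taylorCoeff_mul (f : EntireFunctions) (z : ℂ) :
    HasSum (fun n => taylorCoeff f n * z ^ n) (f z) := by
  refine (Complex.hasSum_taylorSeries_of_entire (differentiable_entire f) 0 z).congr_fun fun n => ?_
  simp only [taylorCoeff, smul_eq_mul, sub_zero]
  ring

/-- The Taylor series of an entire function converges to it in `H(ℂ)`. -/
theorem hasSum_taylor (f : EntireFunctions) :
    HasSum (fun n => taylorCoeff f n • monomial n) f := by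
  have hs : Summable fun n => ((taylorCoeff f n • monomial n : EntireFunctions) : C(ℂ, ℂ)) := by
    refine summable_of_bound fun r hr => ?_
    -- The radius `2r + 1` makes the ratio `r / (2r + 1)` at most `1/2`, and is positive even for `r
    -- = 0`.
    obtain ⟨M, hM, hb⟩ := norm_taylorCoeff_le f (R := 2 * r + 1) (by positivity)
    refine ⟨fun n => M * (1 / 2) ^ n, summable_geometric_two.mul_left _, fun n z hz => ?_⟩
    change ‖taylorCoeff f n * z ^ n‖ ≤ _
    rw [norm_mul, norm_pow]
    calc _ ≤ M / (2 * r + 1) ^ n * r ^ n := by gcongr; exact hb n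
      _ = M * (r / (2 * r + 1)) ^ n := by rw [div_pow]; ring
      _ ≤ _ := by
        refine mul_le_mul_of_nonneg_left (pow_le_pow_left₀ (by positivity) ?_ n) hM
        rw [div_le_div_iff₀ (by positivity) (by norm_num)]; linarith
  obtain ⟨g, hg⟩ := hs
  have hgf : g = f := by
    ext z
    exact (ContinuousMap.hasSum_apply hg z).unique (hasSum_taylorCoeff_mul f z)
  subst hgf
  exact (isInducing_coe.hasSum_iff (g := EntireFunctions.val) _ _).1 hg

theorem taylorCoeff_exponential (l : ℂ) (n : ℕ) :
    taylorCoeff (exponential l) n = l ^ n / n.factorial := by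
  rw [taylorCoeff]
  congr 1
  have : ((exponential l : EntireFunctions) : ℂ → ℂ) = fun z => Complex.exp (l * z) := rfl
  rw [this, iteratedDeriv_cexp_const_mul]
  simp

/-! ### Density of spans of exponentials. -/

/-- A continuous linear functional vanishing on exponentials whose frequencies accumulate
vanishes. -/
theorem functional_eq_zero (L : EntireFunctions →L[ℂ] ℂ) {S : Set ℂ} {p : ℂ}
    (hp : AccPt p (𝓟 S)) (h : ∀ l ∈ S, L (exponential l) = 0) : L = 0 := by
  -- These are the Taylor coefficients of `l ↦ L(e^{lz})`, which is therefore entire; the identity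
  -- theorem kills it, hence every `L(zⁿ)`.
  set c : ℕ → ℂ := fun n => L (monomial n) / n.factorial with hc
  have hsum : ∀ l : ℂ, HasSum (fun n => l ^ n * c n) (L (exponential l)) := fun l => by
    have := (hasSum_taylor (exponential l)).mapL L
    convert this using 2 with n
    rw [map_smul, taylorCoeff_exponential, smul_eq_mul, hc]
    ring
  set P : FormalMultilinearSeries ℂ ℂ ℂ := FormalMultilinearSeries.ofScalars ℂ c with hP
  have hcoeff : ∀ n, P.coeff n = c n := fun n => by
    simp [hP]
  have hrad : P.radius = ⊤ := by
    refine P.radius_eq_top_of_summable_norm fun r => ?_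
    have := (hsum r).summable.norm
    refine this.congr fun n => ?_
    rw [FormalMultilinearSeries.norm_apply_eq_norm_coef, hcoeff]
    simp [mul_comm]
  have hball : HasFPowerSeriesOnBall (fun l => L (exponential l)) P 0 ⊤ :=
    ⟨hrad.ge, by simp, fun {y} _ => by
      simpa [hcoeff, FormalMultilinearSeries.apply_eq_prod_smul_coeff] using hsum y⟩
  have hzero : Set.EqOn (fun l => L (exponential l)) 0 Set.univ := by
    refine AnalyticOnNhd.eqOn_of_preconnected_of_frequently_eq (z₀ := p)
      (fun x _ => hball.analyticAt_of_mem (by simp)) (fun _ _ => analyticAt_const)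
      isPreconnected_univ (Set.mem_univ p) ?_
    have := accPt_iff_frequently_nhdsNE.1 hp
    exact this.mono fun l hl => h l hl
  have hP0 : P = 0 := by
    refine HasFPowerSeriesAt.eq_zero (x := (0 : ℂ)) ?_
    have := hball.hasFPowerSeriesAt
    rwa [show (fun l => L (exponential l)) = 0 from funext fun l => hzero (Set.mem_univ l)] at this
  ext f
  refine (((hasSum_taylor f).mapL L).unique ?_)
  rw [_root_.zero_apply]
  convert hasSum_zero with n
  have h0 : c n = 0 := by rw [← hcoeff, hP0]; rfl
  have hfac : (n.factorial : ℂ) ≠ 0 := by exact_mod_cast n.factorial_ne_zero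
  have : L (monomial n) = 0 := by
    simpa [hc, hfac] using h0
  simp [this]

/-- By Hahn–Banach, a point outside the closed span would be separated from it by a functional that
vanishes on the span, and `functional_eq_zero` forbids this. -/
theorem dense_span_exponential {S : Set ℂ} {p : ℂ} (hp : AccPt p (𝓟 S)) :
    Dense (Submodule.span ℂ (exponential '' S) : Set EntireFunctions) := by
  by_contra hd
  rw [dense_iff_closure_eq, Set.eq_univ_iff_forall] at hd
  push Not at hd
  obtain ⟨x, hx⟩ := hd
  rw [← Submodule.topologicalClosure_coe] at hx
  set M := (Submodule.span ℂ (exponential '' S)).topologicalClosure with hM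
  have hconv : Convex ℝ (M : Set EntireFunctions) := (M.restrictScalars ℝ).convex
  obtain ⟨L, u, hu, hux⟩ := RCLike.geometric_hahn_banach_closed_point (𝕜 := ℂ)
    (s := (M : Set EntireFunctions)) hconv
    (Submodule.isClosed_topologicalClosure _) hx
  have hLM : ∀ a ∈ M, L a = 0 := by
    intro a ha
    by_contra hne
    have hu0 : 0 < u := by simpa using hu 0 M.zero_mem
    -- A functional bounded above on a subspace vanishes there: this multiple of `a` would attain
    -- the strict bound `u`.
    have := hu (((u : ℂ) / L a) • a) (M.smul_mem _ ha)
    rw [map_smul, smul_eq_mul, div_mul_cancel₀ _ hne] at this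
    simp at this
  have hL0 := functional_eq_zero L hp fun l hl =>
    hLM _ (Submodule.le_topologicalClosure _ (Submodule.subset_span ⟨l, hl, rfl⟩))
  have hu0 : 0 < u := by simpa using hu 0 M.zero_mem
  rw [hL0] at hux
  simp at hux
  linarith

end EntireFunctions

/-! ### From transitivity to a hypercyclic algebra. -/

/-- The **Baire criterion** for hypercyclic algebras. -/
theorem supportsHypercyclicAlgebra_of_transitivity {X : Type*} [Ring X] [Algebra ℂ X]
    [TopologicalSpace X] [ContinuousAdd X] [ContinuousMul X] [ContinuousConstSMul ℂ X]
    [T2Space X] [Nontrivial X]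
    [BaireSpace X] [SecondCountableTopology X] (T : X →L[ℂ] X)
    (h : ∀ m : ℕ, 1 ≤ m → ∀ U V W : Set X, IsOpen U → IsOpen V → IsOpen W → U.Nonempty →
      V.Nonempty → (0 : X) ∈ W → ∃ f ∈ U, ∃ q : ℕ, T^[q] (f ^ m) ∈ V ∧
        ∀ j, 1 ≤ j → j < m → T^[q] (f ^ j) ∈ W) :
    SupportsHypercyclicAlgebra ℂ T := by
  have hTc : ∀ q, Continuous T^[q] := fun q => T.continuous.iterate q
  obtain ⟨B, hBc, hB0, hB⟩ := TopologicalSpace.exists_countable_basis X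
  have hBo : ∀ V ∈ B, IsOpen V := fun V hV => hB.isOpen hV
  -- Stating `0 ∈ W` as a premise makes `G` the whole space for the irrelevant basic sets, so all
  -- pairs of basic sets can be indexed. The shift `a.1 + 1` keeps the exponent positive.
  let G : (ℕ × B × B) → Set X := fun a =>
    {f | (0 : X) ∈ (a.2.2 : Set X) → ∃ q : ℕ, T^[q] (f ^ (a.1 + 1)) ∈ (a.2.1 : Set X) ∧
        ∀ j, 1 ≤ j → j < a.1 + 1 → T^[q] (f ^ j) ∈ (a.2.2 : Set X)}
  have hGo : ∀ a, IsOpen (G a) := by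
    rintro ⟨m, V, W⟩
    by_cases h0 : (0 : X) ∈ (W : Set X)
    · have : G (m, V, W) = ⋃ q : ℕ, ((fun f => T^[q] (f ^ (m + 1))) ⁻¹' (V : Set X) ∩
          ⋂ j ∈ Finset.Ico 1 (m + 1), (fun f => T^[q] (f ^ j)) ⁻¹' (W : Set X)) := by
        ext f
        simp [G, h0]
      rw [this]
      refine isOpen_iUnion fun q => ((hBo _ V.2).preimage ((hTc q).comp (continuous_pow _))).inter ?_
      exact isOpen_biInter_finset fun j _ => (hBo _ W.2).preimage ((hTc q).comp (continuous_pow _))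
    · have : G (m, V, W) = Set.univ := by
        ext f; simp [G, h0]
      rw [this]; exact isOpen_univ
  have hGd : ∀ a, Dense (G a) := by
    rintro ⟨m, V, W⟩
    refine dense_iff_inter_open.2 fun U hU hUn => ?_
    by_cases h0 : (0 : X) ∈ (W : Set X)
    · obtain ⟨f, hfU, q, hq⟩ := h (m + 1) (by omega) U V W hU (hBo _ V.2) (hBo _ W.2) hUn
        (Set.nonempty_iff_ne_empty.2 fun he => hB0 (he ▸ V.2)) h0
      exact ⟨f, hfU, fun _ => ⟨q, hq⟩⟩
    · obtain ⟨f, hf⟩ := hUn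
      exact ⟨f, hf, fun h => absurd h h0⟩
  have : Countable B := hBc
  obtain ⟨f, hf⟩ := (dense_iInter_of_isOpen hGo hGd).nonempty
  have key : ∀ m : ℕ, 1 ≤ m → ∀ V W : Set X, V.Nonempty → IsOpen V → IsOpen W → (0 : X) ∈ W →
      ∃ q : ℕ, T^[q] (f ^ m) ∈ V ∧ ∀ j, 1 ≤ j → j < m → T^[q] (f ^ j) ∈ W := by
    rintro m hm V W ⟨v, hv⟩ hV hW h0
    obtain ⟨V', hV', -, hVV⟩ := hB.exists_subset_of_mem_open hv hV
    obtain ⟨W', hW', hW0, hWW⟩ := hB.exists_subset_of_mem_open h0 hW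
    obtain ⟨q, h1, h2⟩ := Set.mem_iInter.1 hf (m - 1, ⟨V', hV'⟩, ⟨W', hW'⟩) hW0
    simp only [Nat.sub_add_cancel hm] at h1 h2
    exact ⟨q, hVV h1, fun j hj hj' => hWW (h2 j hj hj')⟩
  have hzero : ∀ q, T^[q] 0 = 0 := fun q => by
    rw [← FunLike.coe_pow_eq_iterate]; exact map_zero _
  have hf0 : f ≠ 0 := by
    rintro rfl
    obtain ⟨x, hx⟩ := exists_ne (0 : X)
    obtain ⟨q, hq, -⟩ := key 1 le_rfl {0}ᶜ Set.univ ⟨x, hx⟩ isOpen_compl_singleton isOpen_univ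
      (Set.mem_univ _)
    rw [pow_one, hzero] at hq
    exact hq rfl
  refine ⟨NonUnitalAlgebra.adjoin ℂ {f}, fun hbot => hf0 ?_, fun x hx hx0 => ?_⟩
  · have : f ∈ NonUnitalAlgebra.adjoin ℂ {f} := NonUnitalAlgebra.subset_adjoin ℂ rfl
    rw [hbot] at this
    exact NonUnitalAlgebra.mem_bot.1 this
  obtain ⟨P, hP0, rfl⟩ : ∃ P : Polynomial ℂ, P.coeff 0 = 0 ∧ Polynomial.aeval f P = x := by
    -- The algebra generated by `f` consists of the `P(f)` with `P` without constant term.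
    refine NonUnitalAlgebra.adjoin_induction
      (p := fun x _ => ∃ P : Polynomial ℂ, P.coeff 0 = 0 ∧ Polynomial.aeval f P = x)
      ?_ ?_ ?_ ?_ ?_ hx
    · rintro x rfl
      exact ⟨Polynomial.X, by simp, by simp⟩
    · rintro x y - - ⟨P, hP, rfl⟩ ⟨Q, hQ, rfl⟩
      exact ⟨P + Q, by simp [hP, hQ], by simp⟩
    · exact ⟨0, by simp, by simp⟩
    · rintro x y - - ⟨P, hP, rfl⟩ ⟨Q, hQ, rfl⟩
      exact ⟨P * Q, by simp [Polynomial.mul_coeff_zero, hP], by simp⟩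
    · rintro r x - ⟨P, hP, rfl⟩
      exact ⟨Polynomial.C r * P, by simp [hP], by simp [Algebra.smul_def]⟩
  have hPne : P ≠ 0 := by rintro rfl; simp at hx0
  set m := P.natDegree with hm
  have hc : P.coeff m ≠ 0 := by rwa [hm, ← Polynomial.leadingCoeff, Polynomial.leadingCoeff_ne_zero]
  have hm1 : 1 ≤ m := by
    rw [Nat.one_le_iff_ne_zero]
    intro h0
    rw [h0] at hc
    exact hc hP0
  refine dense_iff_inter_open.2 fun V hV ⟨v, hv⟩ => ?_
  -- `Ψ` rebuilds `T^q (P(f))` from the images of the powers of `f`. By continuity it lands in `V`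
  -- once the lower powers go near `0` and the top one near `v` divided by the leading coefficient.
  let Ψ : (Fin m → X) × X → X := fun y => (∑ j : Fin m, P.coeff j • y.1 j) + P.coeff m • y.2
  have hΨ : Continuous Ψ := by
    refine (continuous_finsetSum _ fun j _ => ?_).add (continuous_snd.const_smul _)
    exact ((continuous_apply j).comp continuous_fst).const_smul _
  have hΨv : Ψ (0, (P.coeff m)⁻¹ • v) = v := by simp [Ψ, smul_smul, hc]
  have hnhds : Ψ ⁻¹' V ∈ 𝓝 ((0 : Fin m → X), (P.coeff m)⁻¹ • v) :=
    (hV.preimage hΨ).mem_nhds (by simpa [hΨv] using hv)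
  obtain ⟨S, hS, V', hV', hSV⟩ := mem_nhds_prod_iff.1 hnhds
  rw [nhds_pi, Filter.mem_pi'] at hS
  obtain ⟨I, t, ht, htS⟩ := hS
  obtain ⟨W, hWt, hWo, (hW0 : (0 : X) ∈ W)⟩ := mem_nhds_iff.1
    ((Filter.biInter_mem (s := fun i => t i) (Set.toFinite (Set.univ : Set (Fin m)))).2
      fun i _ => ht i)
  obtain ⟨V₁, hV₁, hV₁o, hV₁v⟩ := mem_nhds_iff.1 hV'
  obtain ⟨q, hqV, hqW⟩ := key m hm1 V₁ W ⟨_, hV₁v⟩ hV₁o hWo hW0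
  refine ⟨_, ?_, q, rfl⟩
  -- The entry at `j = 0` is set to `0`: nothing controls `T^q 1`, and its coefficient vanishes.
  let y : Fin m → X := fun j => if (j : ℕ) = 0 then 0 else T^[q] (f ^ (j : ℕ))
  have hy : Ψ (y, T^[q] (f ^ m)) ∈ V := by
    refine hSV (Set.mk_mem_prod (htS fun i _ => ?_) (hV₁ hqV))
    have hyW : y i ∈ W := by
      simp only [y]
      split_ifs with hi
      · exact hW0
      · exact hqW _ (Nat.one_le_iff_ne_zero.2 hi) i.2
    exact Set.mem_iInter₂.1 (hWt hyW) i (Set.mem_univ i)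
  change T^[q] _ ∈ V
  convert hy using 1
  have hlin : ∀ x, T^[q] x = (T ^ q) x := fun x => by rw [FunLike.coe_pow_eq_iterate]
  rw [Polynomial.aeval_eq_sum_range, Finset.sum_range_succ, ← hm, hlin, map_add, map_sum, map_smul,
    ← hlin]
  simp only [Ψ]
  congr 1
  rw [Finset.sum_range]
  refine Finset.sum_congr rfl fun j _ => ?_
  simp only [y]
  split_ifs with hj
  · simp [hj, hP0]
  · rw [map_smul, hlin]

/-! ### Continuity of `Φ(D)` and its action on exponentials. -/

namespace EntireFunctions

variable {Φ : EntireFunctions}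

/-- `Φ(D)` as a linear map. -/
def convolutionLM (h : IsOfExponentialType Φ) : EntireFunctions →ₗ[ℂ] EntireFunctions where
  toFun := convolutionOperator Φ
  map_add' f g := by
    refine (hasSum_convolutionOperator h (f + g)).unique ?_
    convert (hasSum_convolutionOperator h f).add (hasSum_convolutionOperator h g) using 2 with n
    rw [map_add, smul_add]
  map_smul' c f := by
    refine (hasSum_convolutionOperator h (c • f)).unique ?_
    convert (hasSum_convolutionOperator h f).const_smul c using 2 with n
    rw [map_smul, smul_comm]; rfl

/-- A bound for `Φ(D)` in terms of the sup norms on discs. -/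
theorem exists_convolutionOperator_bound (h : IsOfExponentialType Φ) :
    ∃ A C : ℝ, 0 ≤ A ∧ 0 < C ∧ ∀ (f : EntireFunctions) (r M : ℝ), 0 ≤ M →
      (∀ w, ‖w‖ ≤ r + C → ‖f w‖ ≤ M) → ∀ z, ‖z‖ ≤ r → ‖convolutionOperator Φ f z‖ ≤ A * M := by
  obtain ⟨A, C, hA, hC, hb⟩ := h.exists_taylorCoeff_bound
  -- Cauchy estimates on circles of radius `2C` beat the factor `C ^ n` by `2 ^ n`; the geometric
  -- series gives the constant `2`.
  refine ⟨A * 2, 2 * C, by positivity, by positivity, fun f r M hM hf z hz => ?_⟩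
  have h1 := (hasSum_convolutionOperator h f).mapL (evalCLM z)
  simp only [evalCLM_apply] at h1
  have hbound : ∀ n, ‖evalCLM z (taylorCoeff Φ n • (complexD ^ n) f)‖ ≤ A * M * (1 / 2) ^ n := by
    intro n
    have hfac : (0 : ℝ) < n.factorial := by exact_mod_cast n.factorial_pos
    have h1 := Complex.norm_iteratedDeriv_le_of_forall_mem_sphere_norm_le (c := z) n
      (R := 2 * C) (by positivity) (differentiable_entire f).diffContOnCl (C := M) (fun w hw => by
        refine hf w ?_
        rw [mem_sphere_iff_norm] at hw
        calc ‖w‖ = ‖z + (w - z)‖ := by ring_nf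
          _ ≤ _ := (norm_add_le _ _).trans (by rw [hw]; linarith))
    rw [map_smul, evalCLM_apply, complexD_pow_apply, norm_smul]
    calc _ ≤ (A * C ^ n / n.factorial) * (n.factorial * M / (2 * C) ^ n) := by
          gcongr
          exact hb n
      _ = A * M * (1 / 2) ^ n := by
          rw [mul_pow, div_pow, one_pow]; field_simp
  have := tsum_of_norm_bounded (hasSum_geometric_two.mul_left (A * M)) hbound
  simp only [evalCLM_apply, h1.tsum_eq] at this
  linarith

/-- `Φ(D)` as a continuous linear map. -/
def convolutionCLM (h : IsOfExponentialType Φ) : EntireFunctions →L[ℂ] EntireFunctions where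
  toLinearMap := convolutionLM h
  cont := by
    change Continuous (convolutionLM h)
    refine continuous_of_continuousAt_zero (convolutionLM h) ?_
    obtain ⟨A, C, hA, hC, hb⟩ := exists_convolutionOperator_bound h
    have h0 : Tendsto (fun f : EntireFunctions => (f : C(ℂ, ℂ))) (𝓝 0) (𝓝 0) :=
      continuous_subtype_val.tendsto _
    rw [ContinuousMap.tendsto_iff_forall_isCompact_tendstoUniformlyOn] at h0
    rw [ContinuousAt, map_zero, isInducing_coe.tendsto_nhds_iff]
    change Tendsto _ _ (𝓝 (0 : C(ℂ, ℂ)))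
    rw [ContinuousMap.tendsto_iff_forall_isCompact_tendstoUniformlyOn]
    intro K hK
    rw [Metric.tendstoUniformlyOn_iff]
    intro ε hε
    obtain ⟨r, hr⟩ := hK.isBounded.subset_closedBall (0 : ℂ)
    have h1 := Metric.tendstoUniformlyOn_iff.1 (h0 _ (isCompact_closedBall (0 : ℂ) (r + C)))
      (ε / (A + 1)) (by positivity)
    filter_upwards [h1] with f hf z hz
    have := hb f r (ε / (A + 1)) (by positivity) (fun w hw => by
      have := (hf w (by simpa using hw)).le
      simpa using this) z (by simpa using hr hz)
    simp only [ContinuousMap.zero_apply, Function.comp_apply, dist_zero_left]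
    refine lt_of_le_of_lt this ?_
    rw [mul_div_assoc', div_lt_iff₀ (by positivity)]
    nlinarith

theorem convolutionOperator_exponential (h : IsOfExponentialType Φ) (l : ℂ) :
    convolutionOperator Φ (exponential l) = Φ l • exponential l := by
  refine (hasSum_convolutionOperator h _).unique ?_
  have hD : ∀ n, (complexD ^ n) (exponential l) = l ^ n • exponential l := fun n => by
    refine ext fun z => ?_
    rw [complexD_pow_apply]
    have : ((exponential l : EntireFunctions) : ℂ → ℂ) = fun z => Complex.exp (l * z) := rfl
    rw [this, iteratedDeriv_cexp_const_mul]
    rfl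
  simp only [hD, smul_smul]
  exact (hasSum_taylorCoeff_mul Φ l).smul_const _

theorem convolutionCLM_iterate_exponential (h : IsOfExponentialType Φ) (l : ℂ) (q : ℕ) :
    (convolutionCLM h)^[q] (exponential l) = Φ l ^ q • exponential l := by
  induction q with
  | zero => simp
  | succ q ih =>
    rw [Function.iterate_succ_apply', ih, map_smul]
    change _ • convolutionOperator Φ _ = _
    rw [convolutionOperator_exponential h, smul_smul, pow_succ]

/-- Asymptotics of the iterates of `Φ(D)` on the powers of an exponential polynomial whose
coefficients are geometric sequences. -/
theorem tendsto_iterate_pow (h : IsOfExponentialType Φ) {K : Type*} [Fintype K] [DecidableEq K]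
    (d ρ ν : K → ℂ) (j : ℕ) (S : Finset (Fin j → K))
    (hS : ∀ κ ∈ S, (∏ i, ρ (κ i)) * Φ (∑ i, ν (κ i)) = 1)
    (hS' : ∀ κ ∉ S, ‖(∏ i, ρ (κ i)) * Φ (∑ i, ν (κ i))‖ < 1) :
    Tendsto (fun q => (convolutionCLM h)^[q]
        ((∑ k, (d k * ρ k ^ q) • exponential (ν k)) ^ j)) atTop
      (𝓝 (∑ κ ∈ S, (∏ i, d (κ i)) • exponential (∑ i, ν (κ i)))) := by
  -- Each word `κ` of length `j` contributes one exponential, whose coefficient is geometric in `q`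
  -- with ratio `(∏ ρ) Φ(∑ ν)`.
  have hexp : ∀ q, (convolutionCLM h)^[q] ((∑ k, (d k * ρ k ^ q) • exponential (ν k)) ^ j) =
      ∑ κ : Fin j → K, ((∏ i, d (κ i)) * ((∏ i, ρ (κ i)) * Φ (∑ i, ν (κ i))) ^ q) •
        exponential (∑ i, ν (κ i)) := fun q => by
    rw [Finset.sum_pow', Fintype.piFinset_univ, ← FunLike.coe_pow_eq_iterate, map_sum]
    refine Finset.sum_congr rfl fun κ _ => ?_
    rw [Finset.prod_smul, prod_exponential, map_smul, FunLike.coe_pow_eq_iterate,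
      convolutionCLM_iterate_exponential, smul_smul, Finset.prod_mul_distrib, Finset.prod_pow,
      mul_pow, mul_assoc]
  have hsum : ∑ κ ∈ S, (∏ i, d (κ i)) • exponential (∑ i, ν (κ i)) =
      ∑ κ : Fin j → K, if κ ∈ S then (∏ i, d (κ i)) • exponential (∑ i, ν (κ i)) else 0 := by
    simp
  rw [hsum]
  simp only [hexp]
  refine tendsto_finsetSum _ fun κ _ => ?_
  split_ifs with hκ
  · simp only [hS κ hκ, one_pow, mul_one]
    exact tendsto_const_nhds
  · have := ((tendsto_pow_atTop_nhds_zero_of_norm_lt_one (hS' κ hκ)).const_mul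
      (∏ i, d (κ i))).smul_const (exponential (∑ i, ν (κ i)))
    simpa using this

end EntireFunctions

/-! ### Transitivity from well-chosen frequencies. -/

namespace EntireFunctions

variable {Φ : EntireFunctions}

theorem exists_exponential_sum_mem {S : Set ℂ} {p : ℂ} (hp : AccPt p (𝓟 S))
    {U : Set EntireFunctions} (hU : IsOpen U) (hne : U.Nonempty) :
    ∃ (I : Finset ℂ) (α : ℂ → ℂ), (↑I ⊆ S) ∧ ∑ g : I, α g • exponential (g : ℂ) ∈ U := by
  obtain ⟨x, hxU, hx⟩ := (dense_span_exponential hp).inter_open_nonempty U hU hne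
  obtain ⟨c, hc, rfl⟩ := (Finsupp.mem_span_image_iff_linearCombination ℂ).1 hx
  refine ⟨c.support, c, hc, ?_⟩
  rwa [Finset.sum_coe_sort c.support (fun g => c g • exponential g)]

/-- `Γ` supplies the frequencies approximating `V` and `Δ` those approximating `U`. In the expansion
of a power, `hΔ1` handles words using only `Δ`, `hmid` those with `k < m` letters from `Γ`, and
`hstrict` those with `m` letters from `Γ`, not all equal. -/
theorem transitivity_of_frequencies (h : IsOfExponentialType Φ) {m : ℕ} (hm : 1 ≤ m)
    {w : ℂ} {a δ : ℝ} (ha : 1 < a) {Γ Δ : Set ℂ}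
    (hΓ : ∀ l ∈ Γ, ‖l - w‖ < δ) (hΓa : ∀ l ∈ Γ, a ^ m ≤ ‖Φ l‖)
    (hmid : ∀ k : ℕ, 1 ≤ k → k < m → ∀ z : ℂ, ‖z - k * (w / m)‖ < δ → ‖Φ z‖ < a ^ k)
    (hstrict : ∀ l : Fin m → ℂ, (∀ i, l i ∈ Γ) → (∃ i j, l i ≠ l j) →
      ‖Φ (∑ i, l i / m)‖ ^ m < ∏ i, ‖Φ (l i)‖)
    (hΔ : ∀ g ∈ Δ, ‖g‖ < δ / m)
    (hΔ1 : ∀ j : ℕ, 1 ≤ j → j ≤ m → ∀ g : Fin j → ℂ, (∀ i, g i ∈ Δ) → ‖Φ (∑ i, g i)‖ < 1)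
    {p p' : ℂ} (hp : AccPt p (𝓟 Γ)) (hp' : AccPt p' (𝓟 Δ))
    {U V W : Set EntireFunctions} (hU : IsOpen U) (hV : IsOpen V) (hW : IsOpen W)
    (hUn : U.Nonempty) (hVn : V.Nonempty) (hW0 : (0 : EntireFunctions) ∈ W) :
    ∃ f ∈ U, ∃ q : ℕ, (convolutionCLM h)^[q] (f ^ m) ∈ V ∧
      ∀ j, 1 ≤ j → j < m → (convolutionCLM h)^[q] (f ^ j) ∈ W := by
  classical
  obtain ⟨I, α, hI, hIU⟩ := exists_exponential_sum_mem hp' hU hUn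
  obtain ⟨J, b, hJ, hJV⟩ := exists_exponential_sum_mem hp hV hVn
  have hm0 : m ≠ 0 := by omega
  have hmR : (0 : ℝ) < m := by exact_mod_cast hm
  have hmC : (m : ℂ) ≠ 0 := by exact_mod_cast hm0
  have ha0 : 0 < a := by linarith
  -- The roots are chosen so that `(β l * μ l ^ q) ^ m * Φ l ^ q = b l` for every `q`.
  choose β hβ using fun l : ℂ => IsAlgClosed.exists_pow_nat_eq (b l) hm
  choose μ hμ using fun l : ℂ => IsAlgClosed.exists_pow_nat_eq (Φ l)⁻¹ hm
  have hΦpos : ∀ l ∈ Γ, 0 < ‖Φ l‖ := fun l hl => (pow_pos ha0 m).trans_le (hΓa l hl)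
  have hμa : ∀ l ∈ Γ, ‖μ l‖ ≤ a⁻¹ := fun l hl => by
    refine le_of_pow_le_pow_left₀ hm0 (by positivity) ?_
    rw [← norm_pow, hμ, norm_inv, inv_pow]
    exact inv_anti₀ (by positivity) (hΓa l hl)
  have hainv : a⁻¹ < 1 := inv_lt_one_of_one_lt₀ ha
  let d : I ⊕ J → ℂ := Sum.elim (fun g => α g) (fun l => β l)
  let ρ : I ⊕ J → ℂ := Sum.elim (fun _ => 1) (fun l => μ l)
  let ν : I ⊕ J → ℂ := Sum.elim (fun g => (g : ℂ)) (fun l => (l : ℂ) / m)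
  let F : ℕ → EntireFunctions := fun q => ∑ k, (d k * ρ k ^ q) • exponential (ν k)
  have hIΔ : ∀ g : I, (g : ℂ) ∈ Δ := fun g => hI g.2
  have hJΓ : ∀ l : J, (l : ℂ) ∈ Γ := fun l => hJ l.2
  have hF : Tendsto F atTop (𝓝 (∑ g : I, α g • exponential (g : ℂ))) := by
    have h0 : ∑ g : I, α g • exponential (g : ℂ) =
        ∑ g : I, α g • exponential (g : ℂ) + ∑ l : J, (0 : EntireFunctions) := by simp
    rw [h0]
    simp only [F, Fintype.sum_sum_type]
    refine Tendsto.add ?_ (tendsto_finsetSum _ fun l _ => ?_)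
    · simp [d, ρ, ν]
    · have hl : ‖μ l‖ < 1 := (hμa l (hJΓ l)).trans_lt hainv
      simpa [d, ρ, ν] using ((tendsto_pow_atTop_nhds_zero_of_norm_lt_one hl).const_mul
        (β l)).smul_const (exponential ((l : ℂ) / m))
  have hlt : ∀ j, 1 ≤ j → j ≤ m → ∀ κ : Fin j → I ⊕ J,
      ¬ (j = m ∧ ∃ l : J, κ = fun _ => Sum.inr l) →
      ‖(∏ i, ρ (κ i)) * Φ (∑ i, ν (κ i))‖ < 1 := by
    intro j hj hjm κ hκ
    rw [norm_mul, norm_prod]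
    -- `k` counts the letters from `J`; the cases are `k = 0`, `k = m` and `0 < k < m`.
    set k := (Finset.univ.filter fun i => (κ i).isRight = true).card with hk
    have hkj : k ≤ j := (Finset.card_filter_le _ _).trans (by simp)
    rcases Nat.eq_zero_or_pos k with hk0 | hk0
    · rw [hk, Finset.card_eq_zero, Finset.filter_eq_empty_iff] at hk0
      have : ∀ i, ∃ g : I, κ i = Sum.inl g := fun i => by
        have := @hk0 i (Finset.mem_univ _)
        simpa [Sum.isLeft_iff] using this
      choose g hg using this
      simp only [hg, ρ, ν, Sum.elim_inl, norm_one, Finset.prod_const_one, one_mul]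
      exact hΔ1 j hj hjm _ fun i => hIΔ _
    rcases (hkj.trans hjm).eq_or_lt with hkm | hkm
    · have hjm' : j = m := by omega
      subst hjm'
      have hall : ∀ i, (κ i).isRight = true := by
        have := Finset.card_filter_eq_iff.1 (hk.symm.trans (hkm.trans (by simp)))
        exact fun i => this i (Finset.mem_univ i)
      have : ∀ i, ∃ l : J, κ i = Sum.inr l := fun i => by
        simpa [Sum.isRight_iff] using hall i
      choose l hl using this
      have hne : ∃ i i', (l i : ℂ) ≠ l i' := by
        by_contra! hcon
        refine hκ ⟨rfl, l ⟨0, hj⟩, funext fun i => ?_⟩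
        rw [hl, Subtype.ext (hcon i ⟨0, hj⟩)]
      have hs := hstrict (fun i => l i) (fun i => hJΓ _) hne
      simp only [hl, ρ, ν, Sum.elim_inr]
      -- Raising to the power `j = m` replaces each `μ l` by `(Φ l)⁻¹`, which is the form of
      -- `hstrict`.
      refine lt_of_pow_lt_pow_left₀ j (by norm_num) ?_
      rw [mul_pow, ← Finset.prod_pow, one_pow]
      simp only [← norm_pow (μ _), hμ, norm_inv]
      rw [Finset.prod_inv_distrib, inv_mul_lt_one₀ (Finset.prod_pos fun i _ => hΦpos _ (hJΓ _))]
      exact hs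
    · have h1 : ∏ i, ‖ρ (κ i)‖ ≤ (a⁻¹) ^ k := by
        calc ∏ i, ‖ρ (κ i)‖ ≤ ∏ i, (if (κ i).isRight = true then a⁻¹ else 1) := by
              refine Finset.prod_le_prod (fun _ _ => norm_nonneg _) fun i _ => ?_
              rcases κ i with g | l
              · simp [ρ]
              · simpa [ρ] using hμa l (hJΓ l)
          _ = _ := by rw [Finset.prod_ite]; simp [hk]
      have h2 : ‖∑ i, ν (κ i) - k * (w / m)‖ < δ := by
        have hkw : (k : ℂ) * (w / m) = ∑ i, (if (κ i).isRight = true then w / m else 0) := by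
          rw [Finset.sum_ite]; simp [hk]
        rw [hkw, ← Finset.sum_sub_distrib]
        -- Each of the at most `m` letters contributes an error below `δ / m`, so the total
        -- frequency stays within `δ` of `k * (w / m)`.
        have hterm : ∀ i, ‖ν (κ i) - (if (κ i).isRight = true then w / m else 0)‖ < δ / m := by
          intro i
          rcases κ i with g | l
          · simpa [ν] using hΔ g (hIΔ g)
          · simp only [ν, Sum.elim_inr, Sum.isRight_inr, if_true]
            rw [← sub_div, norm_div, Complex.norm_natCast]
            exact div_lt_div_of_pos_right (hΓ l (hJΓ l)) hmR
        have : Nonempty (Fin j) := ⟨⟨0, hj⟩⟩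
        have hδ : 0 < δ / m := (norm_nonneg _).trans_lt (hterm ⟨0, hj⟩)
        calc _ ≤ ∑ i, ‖ν (κ i) - (if (κ i).isRight = true then w / m else 0)‖ := norm_sum_le _ _
          _ < ∑ i : Fin j, δ / m :=
            Finset.sum_lt_sum_of_nonempty Finset.univ_nonempty fun i _ => hterm i
          _ = j * (δ / m) := by simp
          _ ≤ m * (δ / m) := by gcongr
          _ = δ := by field_simp
      calc _ ≤ (a⁻¹) ^ k * ‖Φ (∑ i, ν (κ i))‖ := by gcongr
        _ < (a⁻¹) ^ k * a ^ k := by gcongr; exact hmid k hk0 hkm _ h2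
        _ = 1 := by rw [← mul_pow, inv_mul_cancel₀ ha0.ne', one_pow]
  have hsmall : ∀ j, 1 ≤ j → j < m →
      Tendsto (fun q => (convolutionCLM h)^[q] (F q ^ j)) atTop (𝓝 0) := fun j hj hjm => by
    have := tendsto_iterate_pow h d ρ ν j ∅ (by simp)
      fun κ _ => hlt j hj hjm.le κ fun hcon => by omega
    rwa [Finset.sum_empty] at this
  have htop : Tendsto (fun q => (convolutionCLM h)^[q] (F q ^ m)) atTop
      (𝓝 (∑ l : J, b l • exponential (l : ℂ))) := by
    have := tendsto_iterate_pow h d ρ ν m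
      (Finset.univ.image fun l : J => fun _ : Fin m => (Sum.inr l : I ⊕ J)) (by
        intro κ hκ
        obtain ⟨l, -, rfl⟩ := Finset.mem_image.1 hκ
        have : Φ l ≠ 0 := norm_pos_iff.1 (hΦpos l (hJΓ l))
        simp [ρ, ν, hμ, mul_div_cancel₀ _ hmC, inv_mul_cancel₀ this])
      fun κ hκ => hlt m hm le_rfl κ fun ⟨_, l, hl⟩ => hκ (Finset.mem_image.2 ⟨l, by simp, hl.symm⟩)
    rw [Finset.sum_image (fun l _ l' _ hll => by
      simpa using congrFun hll ⟨0, hm⟩)] at this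
    convert this using 3 with l
    simp [d, ν, hβ, mul_div_cancel₀ _ hmC]
  have hev : ∀ᶠ q in atTop, F q ∈ U ∧ (convolutionCLM h)^[q] (F q ^ m) ∈ V ∧
      ∀ j ∈ Finset.Ico 1 m, (convolutionCLM h)^[q] (F q ^ j) ∈ W := by
    refine (hF.eventually (hU.mem_nhds hIU)).and ((htop.eventually (hV.mem_nhds hJV)).and ?_)
    refine (Finset.eventually_all _).2 fun j hj => ?_
    rw [Finset.mem_Ico] at hj
    exact (hsmall j hj.1 hj.2).eventually (hW.mem_nhds hW0)
  obtain ⟨q, h1, h2, h3⟩ := hev.exists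
  exact ⟨F q, h1, q, h2, fun j hj hj' => h3 j (Finset.mem_Ico.2 ⟨hj, hj'⟩)⟩

end EntireFunctions

/-! ### Strict convexity of `log |f|` along segments. -/

theorem accPt_of_ray {S : Set ℂ} {p v : ℂ} (hv : v ≠ 0) {η : ℝ} (hη : 0 < η)
    (h : ∀ t : ℝ, 0 < t → t < η → p + t * v ∈ S) : AccPt p (𝓟 S) := by
  rw [accPt_iff_frequently_nhdsNE]
  have h1 : Tendsto (fun t : ℝ => p + t * v) (𝓝[>] 0) (𝓝[≠] p) := by
    refine tendsto_nhdsWithin_iff.2 ⟨?_, ?_⟩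
    · have : Continuous fun t : ℝ => p + t * v := by fun_prop
      simpa using (this.tendsto 0).mono_left nhdsWithin_le_nhds
    · filter_upwards [self_mem_nhdsWithin] with t (ht : 0 < t)
      simp [hv, ht.ne']
  refine h1.frequently (Eventually.frequently ?_)
  filter_upwards [Ioo_mem_nhdsGT hη] with t ht using h t ht.1 ht.2

theorem HasDerivAt.log_norm {f : ℝ → ℂ} {f' : ℂ} {t : ℝ} (hf : HasDerivAt f f' t)
    (h0 : f t ≠ 0) : HasDerivAt (fun x => Real.log ‖f x‖) (f' / f t).re t := by
  have hn : ‖f t‖ ^ 2 ≠ 0 := by positivity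
  have h1 := ((hf.norm_sq).log hn).const_mul (1 / 2)
  have h2 : (fun x => (1 / 2 : ℝ) * Real.log (‖f x‖ ^ 2)) = fun x => Real.log ‖f x‖ := by
    funext x
    rw [Real.log_pow]; push_cast; ring
  rw [h2] at h1
  refine h1.congr_deriv ?_
  rw [Complex.div_re, ← Complex.normSq_eq_norm_sq, Complex.inner]
  simp
  ring

/-- The second derivative of `t ↦ log |f(p + tv)|` is `Re (v² (f'/f)'(p + tv))`, and a suitable
direction `v` makes it positive near `t = 0`. -/
theorem exists_strictConvexOn_log_norm {f : ℂ → ℂ} {O : Set ℂ} (hO : IsOpen O)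
    (hf : Differentiable ℂ f) (h0 : ∀ z ∈ O, f z ≠ 0) {p : ℂ} (hp : p ∈ O)
    (hp' : deriv (fun z => deriv f z / f z) p ≠ 0) :
    ∃ v : ℂ, v ≠ 0 ∧ ∃ η : ℝ, 0 < η ∧ (∀ t ∈ Set.Ioo (-η) η, p + (t : ℂ) * v ∈ O) ∧
      StrictConvexOn ℝ (Set.Ioo (-η) η) fun t : ℝ => Real.log ‖f (p + t * v)‖ := by
  set g : ℂ → ℂ := fun z => deriv f z / f z with hg
  have hgO : DifferentiableOn ℂ g O := fun z hz =>
    ((hf.deriv z).div (hf z) (h0 z hz)).differentiableWithinAt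
  -- With `v² = 1 / g'(p)` the second derivative equals `1` at `t = 0`.
  obtain ⟨v, hv⟩ := IsAlgClosed.exists_pow_nat_eq (deriv g p)⁻¹ (n := 2) (by norm_num)
  have hv0 : v ≠ 0 := by
    rintro rfl
    simp only [ne_eq, OfNat.ofNat_ne_zero, not_false_eq_true, zero_pow] at hv
    exact inv_ne_zero hp' hv.symm
  have hline : Continuous fun t : ℝ => p + (t : ℂ) * v := by fun_prop
  have hline0 : Tendsto (fun t : ℝ => p + (t : ℂ) * v) (𝓝 0) (𝓝 p) := by
    simpa using hline.tendsto 0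
  have hcont : ContinuousAt (fun z => (v ^ 2 * deriv g z).re) p := by
    have : ContinuousAt (deriv g) p :=
      (((hgO.deriv hO) p hp).differentiableAt (hO.mem_nhds hp)).continuousAt
    exact Complex.continuous_re.continuousAt.comp (continuousAt_const.mul this)
  have hpos : ∀ᶠ t : ℝ in 𝓝 0, p + (t : ℂ) * v ∈ O ∧ 0 < (v ^ 2 * deriv g (p + t * v)).re := by
    refine (hline0.eventually (hO.mem_nhds hp)).and
      (hline0.eventually (hcont.eventually (lt_mem_nhds ?_)))
    simp [hv, inv_mul_cancel₀ hp']
  obtain ⟨η, hη, hball⟩ := Metric.eventually_nhds_iff.1 hpos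
  have hball' : ∀ t ∈ Set.Ioo (-η) η, p + (t : ℂ) * v ∈ O ∧
      0 < (v ^ 2 * deriv g (p + t * v)).re := fun t ht => hball (by
    rw [Real.dist_0_eq_abs, abs_lt]; exact ht)
  refine ⟨v, hv0, η, hη, fun t ht => (hball' t ht).1, ?_⟩
  have hlineD : ∀ t : ℝ, HasDerivAt (fun t : ℝ => p + (t : ℂ) * v) v t := fun t => by
    simpa using ((Complex.ofRealCLM.hasDerivAt (x := t)).mul_const v).const_add p
  have hd1 : ∀ t ∈ Set.Ioo (-η) η, HasDerivAt (fun t : ℝ => Real.log ‖f (p + t * v)‖)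
      (v * g (p + t * v)).re t := fun t ht => by
    have := ((hf (p + t * v)).hasDerivAt.scomp t (hlineD t)).log_norm (h0 _ (hball' t ht).1)
    refine this.congr_deriv ?_
    rw [hg, smul_eq_mul, mul_div_assoc, Function.comp_apply]
  have hd2 : ∀ t ∈ Set.Ioo (-η) η, HasDerivAt (fun t : ℝ => (v * g (p + t * v)).re)
      (v ^ 2 * deriv g (p + t * v)).re t := fun t ht => by
    have hgd := (hgO.differentiableAt (hO.mem_nhds (hball' t ht).1)).hasDerivAt
    have := (hgd.scomp t (hlineD t)).const_mul v
    have := Complex.reCLM.hasFDerivAt.comp_hasDerivAt t this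
    refine this.congr_deriv ?_
    rw [Complex.reCLM_apply, smul_eq_mul, sq, mul_assoc]
  refine strictConvexOn_of_deriv2_pos' (convex_Ioo _ _)
    (fun t ht => (hd1 t ht).continuousAt.continuousWithinAt) fun t ht => ?_
  have heq : deriv (fun t : ℝ => Real.log ‖f (p + t * v)‖) =ᶠ[𝓝 t]
      fun t : ℝ => (v * g (p + t * v)).re := by
    filter_upwards [isOpen_Ioo.mem_nhds ht] with x hx using (hd1 x hx).deriv
  rw [Function.iterate_succ, Function.iterate_one, Function.comp_apply, heq.deriv_eq,
    (hd2 t ht).deriv]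
  exact (hball' t ht).2

/-! ### Excluding pure exponentials. -/

/-- An entire function with locally constant logarithmic derivative is an exponential. -/
theorem eq_const_mul_exp_of_deriv_logDeriv_eq_zero {f : ℂ → ℂ} {O : Set ℂ} (hO : IsOpen O)
    (hf : Differentiable ℂ f) (h0 : ∀ z ∈ O, f z ≠ 0) {w : ℂ} (hw : w ∈ O)
    (h : ∀ z ∈ O, deriv (fun z => deriv f z / f z) z = 0) :
    ∃ a b : ℂ, ∀ z, f z = b * Complex.exp (a * z) := by
  obtain ⟨r, hr, hrO⟩ := Metric.isOpen_iff.1 hO w hw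
  obtain ⟨a, ha⟩ := Metric.isOpen_ball.exists_is_const_of_deriv_eq_zero
    (convex_ball w r).isPreconnected (f := fun z => deriv f z / f z)
    (fun z hz => ((hf.deriv z).div (hf z) (h0 z (hrO hz))).differentiableWithinAt)
    fun z hz => h z (hrO hz)
  have heq : deriv f = fun z => a * f z := by
    refine AnalyticOnNhd.eq_of_eventuallyEq (z₀ := w)
      (fun z _ => hf.deriv.analyticAt z) (fun z _ => (hf.const_mul a).analyticAt z) ?_
    filter_upwards [Metric.ball_mem_nhds w hr] with z hz
    exact (div_eq_iff (h0 z (hrO hz))).1 (ha z hz)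
  have hdiff : ∀ z, HasDerivAt (fun z => f z * Complex.exp (-(a * z))) 0 z := fun z => by
    have h1 : HasDerivAt (fun z => -(a * z)) (-a) z := by
      exact ((hasDerivAt_id z).const_mul a).neg.congr_deriv (by simp)
    refine ((hf z).hasDerivAt.mul h1.cexp).congr_deriv ?_
    rw [heq]; ring
  refine ⟨a, f 0, fun z => ?_⟩
  have := is_const_of_deriv_eq_zero (fun z => (hdiff z).differentiableAt)
    (fun z => (hdiff z).deriv) z 0
  simp only [mul_zero, neg_zero, Complex.exp_zero, mul_one] at this
  rw [← this, mul_assoc, ← Complex.exp_add]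
  simp

theorem rayGrowth_const_mul_exp {f : ℂ → ℂ} {a b : ℂ} (hb : b ≠ 0)
    (hf : ∀ z, f z = b * Complex.exp (a * z)) (w : ℂ) :
    rayGrowth f w = (((a * (w / ‖w‖)).re : ℝ) : EReal) := by
  set u : ℂ := w / ‖w‖
  refine Tendsto.limsup_eq ?_
  have h1 : Tendsto (fun r : ℝ => Real.log ‖b‖ / r + (a * u).re) atTop (𝓝 (0 + (a * u).re)) :=
    (tendsto_const_nhds.div_atTop tendsto_id).add tendsto_const_nhds
  rw [zero_add] at h1
  refine ((continuous_coe_real_ereal.tendsto _).comp h1).congr' ?_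
  filter_upwards [eventually_gt_atTop 0] with r hr
  have hn : ‖f (r * u)‖ = ‖b‖ * Real.exp (r * (a * u).re) := by
    rw [hf, norm_mul, Complex.norm_exp, mul_left_comm, Complex.re_ofReal_mul]
  have hpos : 0 < ‖f (r * u)‖ := by rw [hn]; positivity
  have : ENNReal.log ‖f (r * u)‖ₑ = ((Real.log ‖f (r * u)‖ : ℝ) : EReal) := by
    rw [← ofReal_norm, ENNReal.log_ofReal_of_pos hpos]
  change _ = ENNReal.log ‖f (r * u)‖ₑ / (r : EReal)
  rw [this, ← EReal.coe_div, hn, Real.log_mul (by positivity) (by positivity), Real.log_exp,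
    Function.comp_apply]
  congr 1
  field_simp

/-- For `Φ(z) = b e^{az}`, letting `t → 0` in `hi` gives `|b| ≤ 1`, while the growth rate along the
ray satisfies `τ₀ |z₁| = Re (a z₁)`; so `|Φ(z₁)| ≤ e^{τ₀ |z₁|}`, against `hii`. -/
theorem not_const_mul_exp {Φ : EntireFunctions} {z₀ z₁ : ℂ} (hz₁ : z₁ ≠ 0)
    (hi : ∀ t : ℝ, 0 < t → t ≤ 1 → ‖Φ ((t : ℂ) * z₀)‖ < 1)
    (hii : max 1 (EReal.exp (rayGrowth Φ z₁ * (‖z₁‖ : EReal))) < ‖Φ z₁‖ₑ) :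
    ¬ ∃ a b : ℂ, ∀ z, Φ z = b * Complex.exp (a * z) := by
  rintro ⟨a, b, hab⟩
  have hb : b ≠ 0 := by
    rintro rfl
    rw [hab] at hii
    simp at hii
  have hb1 : ‖b‖ ≤ 1 := by
    have hc : Continuous fun t : ℝ => ‖Φ ((t : ℂ) * z₀)‖ := by
      have := (differentiable_entire Φ).continuous
      fun_prop
    have h1 : Tendsto (fun t : ℝ => ‖Φ ((t : ℂ) * z₀)‖) (𝓝[>] 0) (𝓝 ‖b‖) := by
      have := (hc.tendsto 0).mono_left (nhdsWithin_le_nhds (s := Set.Ioi 0))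
      simpa [hab] using this
    refine le_of_tendsto h1 ?_
    filter_upwards [Ioo_mem_nhdsGT (zero_lt_one (α := ℝ))] with t ht using (hi t ht.1 ht.2.le).le
  have h2 := (le_max_right _ _).trans_lt hii
  rw [rayGrowth_const_mul_exp hb hab, ← EReal.coe_mul, EReal.exp_coe, ← ofReal_norm,
    ENNReal.ofReal_lt_ofReal_iff_of_nonneg (Real.exp_pos _).le, hab, norm_mul, Complex.norm_exp] at h2
  have h3 : (a * (z₁ / ‖z₁‖)).re * ‖z₁‖ = (a * z₁).re := by
    have : (‖z₁‖ : ℂ) ≠ 0 := by simpa using hz₁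
    rw [mul_comm, ← Complex.re_ofReal_mul]
    congr 1
    field_simp
  rw [h3] at h2
  nlinarith [Real.exp_pos (a * z₁).re]

/-! ### The base point and strict Jensen. -/

/-- If `F < 1` on `(0, t₀]` and `F 1 > 1`, then `x ↦ F(x)^{1/x}` attains a value exceeding
`1` for the first time at some point of `(0, 1]`. -/
theorem exists_strict_record {F : ℝ → ℝ} (hF : Continuous F) (hF0 : ∀ x, 0 ≤ F x) {t₀ : ℝ}
    (ht₀ : 0 < t₀) (ht₁ : t₀ ≤ 1) (h : ∀ x, 0 < x → x ≤ t₀ → F x < 1) (h1 : 1 < F 1) :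
    ∃ s : ℝ, 0 < s ∧ 1 < F s ∧ ∀ θ : ℝ, 0 < θ → θ < 1 → F (θ * s) < F s ^ θ := by
  set G : ℝ → ℝ := fun x => F x ^ x⁻¹
  have hGc : ContinuousOn G (Set.Icc t₀ 1) := by
    refine hF.continuousOn.rpow (continuousOn_id.inv₀ fun x hx => ?_) fun x hx => Or.inr ?_
    · exact (ht₀.trans_le hx.1).ne'
    · exact inv_pos.2 (ht₀.trans_le hx.1)
  obtain ⟨x₀, hx₀, hmax⟩ := isCompact_Icc.exists_isMaxOn (Set.nonempty_Icc.2 ht₁) hGc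
  have hcl : IsCompact (Set.Icc t₀ 1 ∩ G ⁻¹' {G x₀}) :=
    isCompact_Icc.of_isClosed_subset
      (hGc.preimage_isClosed_of_isClosed isClosed_Icc isClosed_singleton) Set.inter_subset_left
  -- The least maximiser of `G` on `[t₀, 1]` makes the inequality strict at all smaller points of
  -- the interval; below `t₀`, `G < 1` suffices.
  obtain ⟨s, ⟨hs, hsG⟩, hleast⟩ := hcl.exists_isLeast ⟨x₀, hx₀, rfl⟩
  have hs0 : 0 < s := ht₀.trans_le hs.1
  have hsG : G s = G x₀ := hsG
  have hG1 : 1 < G s := by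
    rw [hsG]
    have : G 1 ≤ G x₀ := hmax ⟨ht₁, le_rfl⟩
    refine lt_of_lt_of_le ?_ this
    simpa [G] using h1
  have hFs : F s = G s ^ s := by
    rw [← Real.rpow_mul (hF0 s), inv_mul_cancel₀ hs0.ne', Real.rpow_one]
  refine ⟨s, hs0, ?_, fun θ hθ hθ1 => ?_⟩
  · rw [hFs]
    exact Real.one_lt_rpow hG1 hs0
  have hx0 : 0 < θ * s := mul_pos hθ hs0
  have hxs : θ * s < s := by nlinarith
  have hGlt : G (θ * s) < G s := by
    rcases le_or_gt (θ * s) t₀ with hle | hgt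
    · exact (Real.rpow_lt_one (hF0 _) (h _ hx0 hle) (inv_pos.2 hx0)).trans hG1
    · have hmem : θ * s ∈ Set.Icc t₀ 1 := ⟨hgt.le, hxs.le.trans hs.2⟩
      refine lt_of_le_of_ne (hsG ▸ hmax hmem) fun heq => ?_
      exact absurd (hleast ⟨hmem, heq.trans hsG⟩) (not_le.2 hxs)
  have hFx : F (θ * s) = G (θ * s) ^ (θ * s) := by
    rw [← Real.rpow_mul (hF0 _), inv_mul_cancel₀ hx0.ne', Real.rpow_one]
  rw [hFx, hFs, ← Real.rpow_mul (Real.rpow_nonneg (hF0 _) _), mul_comm s θ]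
  exact Real.rpow_lt_rpow (Real.rpow_nonneg (hF0 _) _) hGlt hx0

/-- Strict Jensen inequality for `log ‖f‖` along a segment, in multiplicative form. -/
theorem StrictConvexOn.norm_pow_lt_prod {f : ℂ → ℂ} {p v : ℂ} {s : Set ℝ}
    (h : StrictConvexOn ℝ s fun t : ℝ => Real.log ‖f (p + t * v)‖)
    (h0 : ∀ t ∈ s, f (p + (t : ℂ) * v) ≠ 0) {m : ℕ} (hm : 1 ≤ m) (t : Fin m → ℝ)
    (ht : ∀ i, t i ∈ s) (hne : ∃ i j, t i ≠ t j) :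
    ‖f (∑ i, (p + (t i : ℂ) * v) / m)‖ ^ m < ∏ i, ‖f (p + (t i : ℂ) * v)‖ := by
  have hmR : (0 : ℝ) < m := by exact_mod_cast hm
  have hmC : (m : ℂ) ≠ 0 := by exact_mod_cast hmR.ne'
  obtain ⟨i₀, j₀, hij⟩ := hne
  have hsum1 : ∑ _i : Fin m, (m : ℝ)⁻¹ = 1 := by simp [hmR.ne']
  have hmem : ∑ i, (m : ℝ)⁻¹ • t i ∈ s :=
    h.1.sum_mem (fun _ _ => by positivity) hsum1 fun i _ => ht i
  have hJ := h.map_sum_lt (t := Finset.univ) (w := fun _ => (m : ℝ)⁻¹) (p := t)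
    (fun _ _ => by positivity) hsum1 (fun i _ => ht i)
    ⟨i₀, Finset.mem_univ _, j₀, Finset.mem_univ _, hij⟩
  have hpt : p + ((∑ i, (m : ℝ)⁻¹ • t i : ℝ) : ℂ) * v = ∑ i, (p + (t i : ℂ) * v) / m := by
    rw [← Finset.sum_div, Finset.sum_add_distrib, ← Finset.smul_sum, ← Finset.sum_mul]
    simp
    field_simp
  have hpos : 0 < ‖f (∑ i, (p + (t i : ℂ) * v) / m)‖ := by
    rw [← hpt]; exact norm_pos_iff.2 (h0 _ hmem)
  have hpos' : ∀ i, 0 < ‖f (p + (t i : ℂ) * v)‖ := fun i => norm_pos_iff.2 (h0 _ (ht i))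
  rw [hpt] at hJ
  simp only [smul_eq_mul] at hJ
  rw [← Finset.mul_sum, inv_mul_eq_div, lt_div_iff₀ hmR, mul_comm] at hJ
  rw [← Real.log_lt_log_iff (by positivity) (Finset.prod_pos fun i _ => hpos' i), Real.log_pow,
    Real.log_prod fun i _ => (hpos' i).ne']
  exact hJ

/-! ### Construction of the two frequency sets. -/

namespace EntireFunctions

/-- `Γ` is a short segment near the record point `w = s z₁` on which `log |Φ|` is strictly convex,
and `Δ` is a short piece of the ray through `z₁` starting at `0`. -/
theorem exists_frequencies {Φ : EntireFunctions}
    (hne : ¬ ∃ a b : ℂ, ∀ z, Φ z = b * Complex.exp (a * z)) {z₁ : ℂ} (hz₁ : z₁ ≠ 0) {t₀ : ℝ}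
    (ht₀ : 0 < t₀) (ht₁ : t₀ ≤ 1) (h : ∀ x : ℝ, 0 < x → x ≤ t₀ → ‖Φ (x * z₁)‖ < 1)
    (h1 : 1 < ‖Φ z₁‖) {m : ℕ} (hm : 1 ≤ m) :
    ∃ (w : ℂ) (a δ : ℝ) (Γ Δ : Set ℂ) (p p' : ℂ), 1 < a ∧
    (∀ l ∈ Γ, ‖l - w‖ < δ) ∧ (∀ l ∈ Γ, a ^ m ≤ ‖Φ l‖) ∧
    (∀ k : ℕ, 1 ≤ k → k < m → ∀ z : ℂ, ‖z - k * (w / m)‖ < δ → ‖Φ z‖ < a ^ k) ∧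
    (∀ l : Fin m → ℂ, (∀ i, l i ∈ Γ) → (∃ i j, l i ≠ l j) →
      ‖Φ (∑ i, l i / m)‖ ^ m < ∏ i, ‖Φ (l i)‖) ∧
    (∀ g ∈ Δ, ‖g‖ < δ / m) ∧
    (∀ j : ℕ, 1 ≤ j → j ≤ m → ∀ g : Fin j → ℂ, (∀ i, g i ∈ Δ) → ‖Φ (∑ i, g i)‖ < 1) ∧
    AccPt p (𝓟 Γ) ∧ AccPt p' (𝓟 Δ) := by
  have hΦc := (differentiable_entire Φ).continuous
  have hmR : (0 : ℝ) < m := by exact_mod_cast hm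
  obtain ⟨s, hs0, hs1, hs⟩ := exists_strict_record (F := fun x : ℝ => ‖Φ (x * z₁)‖)
    (by fun_prop) (fun _ => norm_nonneg _) ht₀ ht₁ h (by simpa using h1)
  set w : ℂ := s * z₁ with hw
  set N : ℝ := ‖Φ w‖ with hN
  have hNpos : 0 < N := by linarith
  set b : ℝ := N ^ (m : ℝ)⁻¹ with hb
  have hb1 : 1 < b := Real.one_lt_rpow hs1 (by positivity)
  have hbk : ∀ k : ℕ, 1 ≤ k → k < m → ‖Φ (k * (w / m))‖ < b ^ k := fun k hk hkm => by
    have := hs (k / m) (by positivity) (by rw [div_lt_one hmR]; exact_mod_cast hkm)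
    rw [hb, ← Real.rpow_natCast, ← Real.rpow_mul hNpos.le, inv_mul_eq_div]
    rwa [show (k : ℂ) * (w / m) = ((k / m * s : ℝ) : ℂ) * z₁ by rw [hw]; push_cast; ring]
  -- Taking `a` just below `b = |Φ(w)|^{1/m}` keeps the finitely many strict inequalities at `kw/m`
  -- and makes `a ^ m < |Φ|` an open condition containing `w`.
  have ha : ∀ᶠ a in 𝓝[<] b, a < b ∧ 1 < a ∧ ∀ k ∈ Finset.Ico 1 m, ‖Φ (k * (w / m))‖ < a ^ k := by
    refine (eventually_mem_nhdsWithin (a := b) (s := Set.Iio b)).and (((lt_mem_nhds hb1).filter_mono nhdsWithin_le_nhds).and ?_)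
    refine (Finset.eventually_all _).2 fun k hk => nhdsWithin_le_nhds ?_
    rw [Finset.mem_Ico] at hk
    exact ((continuous_pow k).tendsto b).eventually (lt_mem_nhds (hbk k hk.1 hk.2))
  obtain ⟨a, hab, ha1, hak⟩ := ha.exists
  have ham : a ^ m < N := by
    have : b ^ m = N := by
      rw [hb, ← Real.rpow_natCast, ← Real.rpow_mul hNpos.le, inv_mul_cancel₀ hmR.ne', Real.rpow_one]
    rw [← this]
    exact pow_lt_pow_left₀ hab (by linarith) (by omega)
  have hδ : ∀ᶠ y in 𝓝 (0 : ℂ), ∀ k ∈ Finset.Ico 1 m, ‖Φ (k * (w / m) + y)‖ < a ^ k := by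
    refine (Finset.eventually_all _).2 fun k hk => ?_
    have hc : Continuous fun y : ℂ => ‖Φ (k * (w / m) + y)‖ := by fun_prop
    exact hc.continuousAt.eventually (gt_mem_nhds (by simpa using hak k hk))
  obtain ⟨δ, hδ0, hδ⟩ := Metric.eventually_nhds_iff.1 hδ
  set O : Set ℂ := Metric.ball w δ ∩ {z | a ^ m < ‖Φ z‖} with hO
  have hOo : IsOpen O := Metric.isOpen_ball.inter (isOpen_lt continuous_const hΦc.norm)
  have hwO : w ∈ O := ⟨Metric.mem_ball_self hδ0, ham⟩
  have hO0 : ∀ z ∈ O, Φ z ≠ 0 := fun z hz =>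
    norm_pos_iff.1 ((pow_pos (by linarith) m).trans hz.2)
  obtain ⟨p, hpO, hp⟩ : ∃ p ∈ O, deriv (fun z => deriv Φ z / Φ z) p ≠ 0 := by
    by_contra! hcon
    exact hne (eq_const_mul_exp_of_deriv_logDeriv_eq_zero hOo (differentiable_entire Φ) hO0 hwO hcon)
  obtain ⟨v, hv, η, hη, hseg, hconv⟩ :=
    exists_strictConvexOn_log_norm hOo (differentiable_entire Φ) hO0 hpO hp
  -- The first bound gives `‖g‖ < δ / m`; the second keeps sums of at most `m` frequencies in `(0,
  -- t₀] z₁`, where `|Φ| < 1`.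
  set ε : ℝ := min (δ / m / ‖z₁‖) (t₀ / m) with hε
  have hz₁' : 0 < ‖z₁‖ := norm_pos_iff.2 hz₁
  have hε0 : 0 < ε := by positivity
  refine ⟨w, a, δ, (fun t : ℝ => p + (t : ℂ) * v) '' Set.Ioo (-η) η,
    (fun t : ℝ => (t : ℂ) * z₁) '' Set.Ioo 0 ε, p, 0, ha1, ?_, ?_, ?_, ?_, ?_, ?_, ?_, ?_⟩
  · rintro _ ⟨t, ht, rfl⟩
    exact mem_ball_iff_norm.1 (hseg t ht).1
  · rintro _ ⟨t, ht, rfl⟩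
    exact (hseg t ht).2.le
  · intro k hk hkm z hz
    have := hδ (y := z - k * (w / m)) (by simpa using hz) k (Finset.mem_Ico.2 ⟨hk, hkm⟩)
    simpa using this
  · intro l hl ⟨i, j, hij⟩
    choose t ht htl using hl
    simp only [← htl] at hij ⊢
    exact hconv.norm_pow_lt_prod (fun t ht => hO0 _ (hseg t ht)) hm t ht
      ⟨i, j, fun heq => hij (by rw [heq])⟩
  · rintro _ ⟨t, ht, rfl⟩
    rw [norm_mul, Complex.norm_real, Real.norm_of_nonneg ht.1.le, ← lt_div_iff₀ hz₁']
    exact ht.2.trans_le (min_le_left _ _)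
  · intro j hj hjm g hg
    choose t ht htg using hg
    have hsum : ∑ i, g i = ((∑ i, t i : ℝ) : ℂ) * z₁ := by
      simp only [← htg]
      push_cast
      rw [Finset.sum_mul]
    have : Nonempty (Fin j) := ⟨⟨0, hj⟩⟩
    rw [hsum]
    refine h _ (Finset.sum_pos (fun i _ => (ht i).1) Finset.univ_nonempty) ?_
    calc ∑ i, t i ≤ ∑ _i : Fin j, t₀ / m :=
          Finset.sum_le_sum fun i _ => (ht i).2.le.trans (min_le_right _ _)
      _ = j * (t₀ / m) := by simp
      _ ≤ m * (t₀ / m) := by gcongr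
      _ = t₀ := by field_simp
  · exact accPt_of_ray hv hη fun t ht ht' => ⟨t, ⟨by linarith, ht'⟩, rfl⟩
  · exact accPt_of_ray hz₁ hε0 fun t ht ht' => ⟨t, ⟨ht, ht'⟩, by simp⟩

end EntireFunctions

end

/-! ### The main theorem. -/

open EntireFunctions

theorem theorem1p5 (Φ : EntireFunctions) (hΦ : IsOfExponentialType Φ) (z₀ z₁ : ℂ)
    (hz₁ : z₁ ≠ 0) (hz₀ : z₀ ∈ openSegment ℝ 0 z₁)
    (hi : ∀ t : ℝ, 0 < t → t ≤ 1 → ‖Φ ((t : ℂ) * z₀)‖ < 1)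
    (hii : max 1 (EReal.exp (rayGrowth Φ z₁ * (‖z₁‖ : EReal))) < ‖Φ z₁‖ₑ) :
    SupportsHypercyclicAlgebra ℂ (convolutionOperator Φ) := by
  obtain ⟨x, t₀, hx, ht₀, hxt, rfl⟩ := hz₀
  rw [smul_zero, zero_add, Complex.real_smul] at hi
  have hne := not_const_mul_exp hz₁ hi hii
  have h1 : 1 < ‖Φ z₁‖ := by
    have := (le_max_left _ _).trans_lt hii
    rwa [← ofReal_norm, ENNReal.one_lt_ofReal] at this
  have : Nontrivial EntireFunctions := ⟨⟨0, 1, fun h => by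
    simpa using congrArg (fun f : EntireFunctions => f 0) h⟩⟩
  refine supportsHypercyclicAlgebra_of_transitivity (X := EntireFunctions) (convolutionCLM hΦ)
    fun m hm U V W hU hV hW hUn hVn hW0 => ?_
  obtain ⟨w, a, δ, Γ, Δ, p, p', ha, hΓ, hΓa, hmid, hstrict, hΔ, hΔ1, hp, hp'⟩ :=
    -- Since `z₀ = t₀ z₁`, the hypothesis on `(0, z₀]` is reparametrised by `x / t₀`.
    exists_frequencies hne hz₁ ht₀ (by linarith) (fun x hx hxt => by
      have := hi (x / t₀) (by positivity) ((div_le_one ht₀).2 hxt)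
      have ht₀' : (t₀ : ℂ) ≠ 0 := by exact_mod_cast ht₀.ne'
      rwa [← mul_assoc, Complex.ofReal_div, div_mul_cancel₀ _ ht₀'] at this) h1 hm
  exact transitivity_of_frequencies hΦ hm ha hΓ hΓa hmid hstrict hΔ hΔ1 hp hp' hU hV hW hUn hVn hW0
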